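/- Let $d\ge 2$ be an integer and let $\mathbb T_d$ be the infinite rooted tree in which every vertex has exactly $d$ children. The frog model $\mathrm{FM}(d,q,p)$ with death $1-q$ and drift $p$ is the following discrete-time process on $\mathbb T_d$. Initially there is one active frog at the root and one sleeping frog at each non-root vertex. At each time step every active frog, independently of all other frogs and of the past, dies with probability $1-q$; if it survives, it moves to the parent of its current vertex with probability $p$ (at the root it instead stays in place with probability $p$), and with probability $1-p$ it moves to a uniformly chosen child of its current vertex. Whenever an active frog visits a vertex with a sleeping frog, the sleeping frog becomes active. A realization is called recurrent if the root is visited by infinitely many distinct active frogs. **Theorem.** For every integer $d\ge 2$ and all $(p,q)\in[0.4950,0.4975]\times[0.9999998,1]$, $$\mathbf P\big(\mathrm{FM}(d,q,p)\text{ is recurrent}\big)>0.$$ -/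

import Mathlib

open MeasureTheory

/-- Vertices of the infinite rooted `d`-ary tree: the root is `[]`, the children of `x` are the
vertices `i :: x` for `i : Fin d`, and the parent of a non-root vertex `x` is `x.tail`. -/
abbrev TreeVertex (d : ℕ) : Type := List (Fin d)

/-- What an active frog is told when it is about to take a step: die, move towards the root, or
move to the `i`-th child of its current position. -/
inductive FrogStep (d : ℕ) : Type
  | die : FrogStep d
  | toward : FrogStep d
  | away (i : Fin d) : FrogStep d

instance (d : ℕ) : MeasurableSpace (FrogStep d) := ⊤

/-- The law of a single step: the frog dies with probability `1 - q`; if it survives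
(probability `q`) it moves towards the root with probability `p`, and to a uniformly chosen child
with probability `1 - p`. -/
noncomputable def frogStepLaw (d : ℕ) (q p : ℝ) : Measure (FrogStep d) :=
  ENNReal.ofReal (1 - q) • Measure.dirac FrogStep.die
    + ENNReal.ofReal (q * p) • Measure.dirac FrogStep.toward
    + ∑ i : Fin d, ENNReal.ofReal (q * ((1 - p) / d)) • Measure.dirac (FrogStep.away i)

theorem isProbabilityMeasure_frogStepLaw {d : ℕ} (hd : d ≠ 0) {q p : ℝ}
    (hq : q ∈ Set.Icc (0 : ℝ) 1) (hp : p ∈ Set.Icc (0 : ℝ) 1) :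
    IsProbabilityMeasure (frogStepLaw d q p) := by
  have hq0 := hq.1
  have hp0 := hp.1
  have h1 : 0 ≤ 1 - q := sub_nonneg.2 hq.2
  have h2 : 0 ≤ 1 - p := sub_nonneg.2 hp.2
  have hd' : (d : ℝ) ≠ 0 := Nat.cast_ne_zero.2 hd
  constructor
  simp only [frogStepLaw, Measure.coe_add, Measure.coe_finsetSum, Measure.coe_smul,
    Pi.add_apply, Finset.sum_apply, Pi.smul_apply, measure_univ, smul_eq_mul, mul_one]
  rw [← ENNReal.ofReal_sum_of_nonneg (fun _ _ => by positivity),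
    ← ENNReal.ofReal_add h1 (by positivity), ← ENNReal.ofReal_add (by positivity)
      (Finset.sum_nonneg fun _ _ => by positivity)]
  simp only [Finset.sum_const, Finset.card_univ, Fintype.card_fin, nsmul_eq_mul]
  rw [show 1 - q + q * p + d * (q * ((1 - p) / d)) = 1 by field_simp; ring, ENNReal.ofReal_one]

/-- The randomness of the model: `ω (v, k)` is the instruction that the frog which starts at the
vertex `v` uses for its `(k + 1)`-st step after being activated. -/
abbrev FrogInstructions (d : ℕ) : Type := TreeVertex d × ℕ → FrogStep d

/-- All instructions, of all frogs and for all steps, are independent with law `frogStepLaw`. -/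
noncomputable def frogMeasure (d : ℕ) (q p : ℝ) : Measure (FrogInstructions d) :=
  Measure.infinitePi fun _ : TreeVertex d × ℕ => frogStepLaw d q p

/-- The state of a frog: asleep (at its starting vertex), active at the vertex `x` having taken
`k` steps since its activation, or dead. -/
inductive FrogState (d : ℕ) : Type
  | asleep : FrogState d
  | active (x : TreeVertex d) (k : ℕ) : FrogState d
  | dead : FrogState d

/-- The frog is active and located at `x`. -/
def FrogState.IsActiveAt {d : ℕ} (s : FrogState d) (x : TreeVertex d) : Prop :=
  ∃ k : ℕ, s = FrogState.active x k

/-- A configuration gives the state of each frog; frogs are named by their starting vertices. -/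
abbrev FrogConfig (d : ℕ) : Type := TreeVertex d → FrogState d

/-- At time `0` the frog at the root is active and all other frogs are asleep. -/
def FrogConfig.initial (d : ℕ) : FrogConfig d
  | [] => FrogState.active [] 0
  | _ :: _ => FrogState.asleep

/-- The state of the frog `v` after its next step. A step towards the root from the root stays in
place, since `[].tail = []`. -/
def FrogState.move {d : ℕ} (ω : FrogInstructions d) (v : TreeVertex d) :
    FrogState d → FrogState d
  | FrogState.asleep => FrogState.asleep
  | FrogState.dead => FrogState.dead
  | FrogState.active x k =>
    match ω (v, k) with
    | FrogStep.die => FrogState.dead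
    | FrogStep.toward => FrogState.active x.tail (k + 1)
    | FrogStep.away i => FrogState.active (i :: x) (k + 1)

open Classical in
/-- One unit of time: all active frogs take a step (or die), and then each sleeping frog whose
vertex is now occupied by an active frog becomes active. -/
noncomputable def FrogConfig.next {d : ℕ} (ω : FrogInstructions d) (η : FrogConfig d) :
    FrogConfig d := fun v =>
  if η v = FrogState.asleep ∧ ∃ u, ((η u).move ω u).IsActiveAt v then FrogState.active v 0
  else (η v).move ω v

/-- The frog model: the configuration at time `n`. -/
noncomputable def frogModel {d : ℕ} (ω : FrogInstructions d) : ℕ → FrogConfig d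
  | 0 => FrogConfig.initial d
  | n + 1 => (frogModel ω n).next ω

/-- A realization is recurrent if the root is visited by infinitely many active frogs. -/
def FrogRecurrent {d : ℕ} (ω : FrogInstructions d) : Prop :=
  {v : TreeVertex d | ∃ n : ℕ, (frogModel ω n v).IsActiveAt []}.Infinite

/-! ### Activation along walks, and relay chains that return to the root -/

section Deterministic

variable {d : ℕ} {ω : FrogInstructions d}

/-! A branching process inside the frog model is compared with the cost of returning to the root. A
frog visits a given child with probability at least `r = 0.9 / d` and a given vertex `k` levels up
with probability at least `0.98 ^ k`; both come from an explicit subharmonic function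
(`potential_le_step`, `le_measureReal_hits`). One frog's descendants alone would be subcritical, as
`d * r < 1`. But a frog and the child it wakes together reach a given grandchild with probability at
least `2 * r ^ 2 - r ^ 3` (`le_measureReal_relay`), hence at least 1.25 grandchildren on average.
This beats the factor `0.98 ^ 2` lost on the way back through two levels.

So the expected number of returning frogs from depth `2 * n` does not decay. A second-moment bound
(`measureReal_iUnion_inter_ge`), with independence of disjoint subtrees, turns this by induction
into a bound below on the return probability, uniform in `n` (`le_measureReal_returns`). Returns
then occur for infinitely many `n` with positive probability, each `n` supplying a different frog
(`frogRecurrent_pos`). -/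

theorem frogModel_succ_of_ne_asleep {n : ℕ} {v : TreeVertex d}
    (h : frogModel ω n v ≠ FrogState.asleep) :
    frogModel ω (n + 1) v = (frogModel ω n v).move ω v := by
  simp [frogModel, FrogConfig.next, h]

/-- The frog `v` is activated at some time. -/
def Activated (ω : FrogInstructions d) (v : TreeVertex d) : Prop :=
  ∃ n, frogModel ω n v = FrogState.active v 0

theorem activated_of_ne_asleep {n : ℕ} {v : TreeVertex d}
    (h : frogModel ω n v ≠ FrogState.asleep) : Activated ω v := by
  induction n with
  | zero =>
    cases v with
    | nil => exact ⟨0, rfl⟩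
    | cons i x => exact absurd rfl h
  | succ n ih =>
    by_cases hn : frogModel ω n v = FrogState.asleep
    · refine ⟨n + 1, ?_⟩
      simp only [frogModel, FrogConfig.next] at h ⊢
      by_cases hu : ∃ u, ((frogModel ω n u).move ω u).IsActiveAt v
      · rw [if_pos ⟨hn, hu⟩]
      · rw [if_neg fun H => hu H.2, hn] at h
        exact absurd rfl h
    · exact ih hn

theorem activated_of_isActiveAt {m : ℕ} {v w : TreeVertex d}
    (h : (frogModel ω m v).IsActiveAt w) : Activated ω w := by
  obtain ⟨k, hk⟩ := h
  cases m with
  | zero =>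
    cases v with
    | nil =>
      have : w = [] := by
        simp only [frogModel, FrogConfig.initial, FrogState.active.injEq] at hk
        exact hk.1.symm
      exact this ▸ ⟨0, rfl⟩
    | cons i x => exact absurd hk (by simp [frogModel, FrogConfig.initial])
  | succ m =>
    by_cases hw : frogModel ω m w = FrogState.asleep
    · by_cases hv : frogModel ω m v = FrogState.asleep ∧
          ∃ u, ((frogModel ω m u).move ω u).IsActiveAt v
      · simp only [frogModel, FrogConfig.next, if_pos hv, FrogState.active.injEq] at hk
        rw [← hk.1]
        exact ⟨m + 1, by simp only [frogModel, FrogConfig.next, if_pos hv]⟩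
      · simp only [frogModel, FrogConfig.next, if_neg hv] at hk
        exact ⟨m + 1, by
          simp only [frogModel, FrogConfig.next]
          rw [if_pos ⟨hw, v, k, hk⟩]⟩
    · exact activated_of_ne_asleep hw

/-- The walk which is at `x` and follows the instructions `k`, `k + 1`, … of the frog `v` is at
`w` within its next `n` steps. -/
def Reaches (ω : FrogInstructions d) (v w : TreeVertex d) : ℕ → ℕ → TreeVertex d → Prop
  | 0, _, x => x = w
  | n + 1, k, x => x = w ∨
    (ω (v, k) = FrogStep.toward ∧ Reaches ω v w n (k + 1) x.tail) ∨
    ∃ i, ω (v, k) = FrogStep.away i ∧ Reaches ω v w n (k + 1) (i :: x)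

theorem exists_isActiveAt_of_reaches {v w : TreeVertex d} {n k m : ℕ} {x : TreeVertex d}
    (hm : frogModel ω m v = FrogState.active x k) (h : Reaches ω v w n k x) :
    ∃ m, (frogModel ω m v).IsActiveAt w := by
  induction n generalizing k m x with
  | zero => exact ⟨m, k, by rw [hm, show x = w from h]⟩
  | succ n ih =>
    have hs : frogModel ω (m + 1) v = (FrogState.active x k).move ω v := by
      rw [frogModel_succ_of_ne_asleep (by simp [hm]), hm]
    rcases h with h | ⟨h, h'⟩ | ⟨i, h, h'⟩
    · exact ⟨m, k, by rw [hm, h]⟩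
    · exact ih (by rw [hs]; simp only [FrogState.move, h]) h'
    · exact ih (by rw [hs]; simp only [FrogState.move, h]) h'

/-- The walk of the frog `v` visits `w`. -/
def Hits (ω : FrogInstructions d) (v w : TreeVertex d) : Prop := ∃ n, Reaches ω v w n 0 v

theorem Activated.exists_isActiveAt {v w : TreeVertex d} (hv : Activated ω v)
    (h : Hits ω v w) : ∃ m, (frogModel ω m v).IsActiveAt w := by
  obtain ⟨m, hm⟩ := hv
  obtain ⟨n, hn⟩ := h
  exact exists_isActiveAt_of_reaches hm hn

theorem Activated.of_hits {v w : TreeVertex d} (hv : Activated ω v) (h : Hits ω v w) :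
    Activated ω w := by
  obtain ⟨m, hm⟩ := hv.exists_isActiveAt h
  exact activated_of_isActiveAt hm

/-- The frogs `x` and `i :: x` alone carry the activation from `x` to its grandchild
`j :: i :: x`. -/
def Relay (ω : FrogInstructions d) (x : TreeVertex d) (i j : Fin d) : Prop :=
  Hits ω x (j :: i :: x) ∨ (Hits ω x (i :: x) ∧ Hits ω (i :: x) (j :: i :: x))

/-- A chain of `n` relays leads from `x` to a vertex whose frog visits the root. -/
def Returns (ω : FrogInstructions d) : ℕ → TreeVertex d → Prop
  | 0, x => Hits ω x []
  | n + 1, x => ∃ ij : Fin d × Fin d, Relay ω x ij.1 ij.2 ∧ Returns ω n (ij.2 :: ij.1 :: x)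

theorem Activated.exists_visitor {n : ℕ} {x : TreeVertex d} (hx : Activated ω x)
    (h : Returns ω n x) :
    ∃ v : TreeVertex d, v.length = x.length + 2 * n ∧
      ∃ m, (frogModel ω m v).IsActiveAt [] := by
  induction n generalizing x with
  | zero => exact ⟨x, rfl, hx.exists_isActiveAt h⟩
  | succ n ih =>
    obtain ⟨⟨i, j⟩, h1, h2⟩ := h
    obtain ⟨v, hv, hm⟩ := ih (h1.elim hx.of_hits fun h => (hx.of_hits h.1).of_hits h.2) h2
    refine ⟨v, ?_, hm⟩
    simp only [List.length_cons] at hv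
    omega

theorem frogRecurrent_of_frequently_returns (h : ∀ N, ∃ n ≥ N, Returns ω n []) :
    FrogRecurrent ω := by
  refine Set.infinite_of_forall_exists_gt
    (s := List.length '' {v : TreeVertex d | ∃ n : ℕ, (frogModel ω n v).IsActiveAt []})
    (fun N => ?_) |>.of_image
  -- The visitor found has depth `2 * n`, so `n ≥ N + 1` makes that depth exceed `N`; unbounded
  -- depths mean infinitely many frogs.
  obtain ⟨n, hn, hr⟩ := h (N + 1)
  obtain ⟨v, hv, hm⟩ := Activated.exists_visitor ⟨0, rfl⟩ hr
  refine ⟨_, ⟨v, hm, rfl⟩, ?_⟩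
  simp only [List.length_nil] at hv
  omega

end Deterministic

/-! ### A subharmonic lower bound for hitting probabilities -/

section Potential

variable {d : ℕ}

/-- With `j` the distance from `w` to the last common vertex of the paths from the root to `w` and
to `x`, and `m` the distance from that vertex to `x`, this is `r ^ j * h ^ m`. -/
noncomputable def potential (r h : ℝ) (w : TreeVertex d) : TreeVertex d → ℝ
  | [] => r ^ w.length
  | i :: x => if (i :: x) <:+ w then r ^ (w.length - (x.length + 1)) else h * potential r h w x

variable {r h : ℝ} {w : TreeVertex d}

theorem potential_of_suffix {x : TreeVertex d} (hx : x <:+ w) :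
    potential r h w x = r ^ (w.length - x.length) := by
  cases x with
  | nil => simp [potential]
  | cons i x => simp [potential, hx]

theorem potential_cons_of_not_suffix {i : Fin d} {x : TreeVertex d} (hx : ¬ (i :: x) <:+ w) :
    potential r h w (i :: x) = h * potential r h w x := by
  simp [potential, hx]

theorem potential_nonneg (hr : 0 ≤ r) (hh : 0 ≤ h) (x : TreeVertex d) :
    0 ≤ potential r h w x := by
  induction x with
  | nil => exact pow_nonneg hr _
  | cons i x ih =>
    simp only [potential]
    split
    · exact pow_nonneg hr _
    · exact mul_nonneg hh ih

theorem potential_le_one (hr : 0 ≤ r) (hr1 : r ≤ 1) (hh : 0 ≤ h) (hh1 : h ≤ 1)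
    (x : TreeVertex d) : potential r h w x ≤ 1 := by
  induction x with
  | nil => exact pow_le_one₀ hr hr1
  | cons i x ih =>
    simp only [potential]
    split
    · exact pow_le_one₀ hr hr1
    · exact mul_le_one₀ hh1 (potential_nonneg hr hh x) ih

theorem potential_nil_eq (x : TreeVertex d) : potential r h [] x = h ^ x.length := by
  induction x with
  | nil => simp [potential]
  | cons i x ih => simp [potential, ih, pow_succ']

/-- The potential is subharmonic off `w`, for the walk killed at rate `1 - q`. -/
theorem potential_le_step {p q : ℝ} (hr : 0 ≤ r) (hr1 : r ≤ 1) (hh : 0 ≤ h)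
    (hp : 0 ≤ p) (hq : 0 ≤ q)
    (hup : h ≤ q * (p + (1 - p) * h ^ 2))
    (hdown : r ≤ q * (p * r ^ 2 + (1 - p) / d * (1 + (d - 1) * (h * r))))
    {x : TreeVertex d} (hx : x ≠ w) :
    potential r h w x ≤ q * (p * potential r h w x.tail +
      ∑ i : Fin d, (1 - p) / d * potential r h w (i :: x)) := by
  by_cases hs : x <:+ w
  · obtain ⟨t, rfl⟩ := hs
    rcases List.eq_nil_or_concat t with rfl | ⟨t, i, rfl⟩
    · exact absurd rfl hx
    have hi : (i :: x) <:+ (t ++ [i]) ++ x := ⟨t, by simp⟩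
    have hd : (1 : ℝ) ≤ d := by exact_mod_cast i.pos
    rw [List.concat_eq_append]
    set W := (t ++ [i]) ++ x with hW
    have hlen : W.length = t.length + 1 + x.length := by
      simp only [hW, List.length_append, List.length_singleton]
    have hxs : x <:+ W := ⟨_, rfl⟩
    have h0 : potential r h W x = r ^ (t.length + 1) := by
      rw [potential_of_suffix hxs, hlen]; congr 1; omega
    have h1 : potential r h W (i :: x) = r ^ t.length := by
      rw [potential_of_suffix hi, hlen]; congr 1; simp only [List.length_cons]; omega
    have h2 : ∀ j ≠ i, potential r h W (j :: x) = h * r ^ (t.length + 1) := by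
      intro j hj
      rw [potential_cons_of_not_suffix, h0]
      rintro ⟨t', ht'⟩
      have : (t' ++ [j]) ++ x = (t ++ [i]) ++ x := by simpa [hW] using ht'
      have := List.append_cancel_right this
      have := (List.append_inj' this rfl).2
      simp at this
      exact hj this
    -- Only an inequality: at the root the step towards the root stays in place, which is closer to
    -- the target.
    have h3 : r ^ (t.length + 2) ≤ potential r h W x.tail := by
      rw [potential_of_suffix ((List.tail_suffix x).trans hxs)]
      apply pow_le_pow_of_le_one hr hr1
      rw [hlen, List.length_tail]; omega
    have h4 : ∑ j : Fin d, (1 - p) / d * potential r h W (j :: x) =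
        (1 - p) / d * (r ^ t.length + (d - 1) * (h * r ^ (t.length + 1))) := by
      rw [← Finset.mul_sum, ← Finset.add_sum_erase _ _ (Finset.mem_univ i), h1,
        Finset.sum_congr rfl fun j hj => h2 j (Finset.ne_of_mem_erase hj), Finset.sum_const,
        Finset.card_erase_of_mem (Finset.mem_univ i), Finset.card_univ, Fintype.card_fin,
        nsmul_eq_mul, Nat.cast_sub i.pos, Nat.cast_one]
    rw [h0, h4]
    calc r ^ (t.length + 1) = r ^ t.length * r := pow_succ _ _
      _ ≤ r ^ t.length * (q * (p * r ^ 2 + (1 - p) / d * (1 + (d - 1) * (h * r)))) := by gcongr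
      _ = q * (p * r ^ (t.length + 2) +
          (1 - p) / d * (r ^ t.length + (d - 1) * (h * r ^ (t.length + 1)))) := by ring
      _ ≤ _ := by gcongr
  · cases x with
    | nil => exact absurd (List.nil_suffix) hs
    | cons i x =>
      have hd : (d : ℝ) ≠ 0 := by exact_mod_cast i.pos.ne'
      have h2 : ∀ j, potential r h w (j :: i :: x) = h * (h * potential r h w x) := by
        intro j
        rw [potential_cons_of_not_suffix fun H => hs ((List.suffix_cons _ _).trans H),
          potential_cons_of_not_suffix hs]
      simp only [h2, potential_cons_of_not_suffix hs, List.tail_cons, Finset.sum_const,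
        Finset.card_univ, Fintype.card_fin, nsmul_eq_mul]
      calc h * potential r h w x ≤ (q * (p + (1 - p) * h ^ 2)) * potential r h w x :=
            mul_le_mul_of_nonneg_right hup (potential_nonneg hr hh x)
        _ = _ := by field_simp

end Potential

/-! ### A second-moment bound for unions -/

open ProbabilityTheory in
/-- Second-order lower bound for the probability of a union of events `E i ∩ U i`. -/
theorem measureReal_iUnion_inter_ge {Ω ι : Type*} [MeasurableSpace Ω] [Fintype ι]
    {μ : Measure Ω} [IsProbabilityMeasure μ] {E U : ι → Set Ω} {e s : ℝ}
    (hE : ∀ i, MeasurableSet (E i)) (hU : ∀ i, MeasurableSet (U i))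
    (hEU : ∀ i, μ.real (E i ∩ U i) = μ.real (E i) * μ.real (U i))
    (hUU : ∀ i j, i ≠ j → μ.real (U i ∩ U j) = μ.real (U i) * μ.real (U j))
    (hs : 0 < s) (hle : ∀ i, e ≤ μ.real (E i)) (hsU : ∀ i, s ≤ μ.real (U i)) :
    Fintype.card ι * (e * s) - (Fintype.card ι * s) ^ 2 ≤ μ.real (⋃ i, E i ∩ U i) := by
  classical
  set B : ι → Set Ω := fun i => E i ∩ U i
  have hB : ∀ i, MeasurableSet (B i) := fun i => (hE i).inter (hU i)
  -- Thinning by these weights replaces each probability of `U i` by exactly `s`; otherwise a large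
  -- one would spoil the quadratic term.
  set w : ι → ℝ := fun i => s / μ.real (U i) with hw
  have hUpos : ∀ i, 0 < μ.real (U i) := fun i => hs.trans_le (hsU i)
  have hw0 : ∀ i, 0 ≤ w i := fun i => div_nonneg hs.le (hUpos i).le
  have hw1 : ∀ i, w i ≤ 1 := fun i => (div_le_one (hUpos i)).2 (hsU i)
  have hwU : ∀ i, w i * μ.real (U i) = s := fun i => div_mul_cancel₀ _ (hUpos i).ne'
  have hint : ∀ A : Set Ω, MeasurableSet A → Integrable (A.indicator (1 : Ω → ℝ)) μ :=
    fun A hA => (integrable_const (1 : ℝ)).indicator hA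
  have hpt : ∀ ω, (∑ i, w i * (B i).indicator (1 : Ω → ℝ) ω) -
      (∑ i, ∑ j, if i = j then 0 else w i * w j * (B i ∩ B j).indicator (1 : Ω → ℝ) ω) ≤
      (⋃ i, B i).indicator (1 : Ω → ℝ) ω := by
    intro ω
    set b : ι → ℝ := fun i => w i * (B i).indicator (1 : Ω → ℝ) ω with hb
    have hb0 : ∀ i, 0 ≤ b i := fun i =>
      mul_nonneg (hw0 i) (Set.indicator_nonneg (fun _ _ => zero_le_one) _)
    have hb1 : ∀ i, b i ≤ 1 := fun i =>
      mul_le_one₀ (hw1 i) (Set.indicator_nonneg (fun _ _ => zero_le_one) _)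
        (Set.indicator_le_self' (fun _ _ => zero_le_one) _)
    have h1 : (∑ i, ∑ j, if i = j then 0 else
        w i * w j * (B i ∩ B j).indicator (1 : Ω → ℝ) ω) = (∑ i, b i) ^ 2 - ∑ i, b i ^ 2 := by
      rw [sq, Finset.sum_mul_sum, ← Finset.sum_sub_distrib]
      refine Finset.sum_congr rfl fun i _ => ?_
      have : b i ^ 2 = ∑ j, if i = j then b i * b j else 0 := by simp [sq]
      rw [this, ← Finset.sum_sub_distrib]
      refine Finset.sum_congr rfl fun j _ => ?_
      split_ifs
      · simp
      · simp only [hb, Set.inter_indicator_one, Pi.mul_apply]; ring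
    rw [h1]
    by_cases hω : ω ∈ ⋃ i, B i
    · rw [Set.indicator_of_mem hω]
      -- With `S = ∑ b i`, the left side is then at most `2 * S - S ^ 2 ≤ 1`.
      have h2 : ∑ i, b i ^ 2 ≤ ∑ i, b i :=
        Finset.sum_le_sum fun i _ => by nlinarith [hb0 i, hb1 i]
      simp only [Pi.one_apply]
      nlinarith [sq_nonneg (∑ i, b i - 1)]
    · rw [Set.indicator_of_notMem hω]
      have : ∀ i, b i = 0 := fun i => by
        have : ω ∉ B i := fun h => hω (Set.mem_iUnion.2 ⟨i, h⟩)
        simp [hb, this]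
      simp [this]
  have hi2 : ∀ i j, Integrable (fun ω => if i = j then 0 else
      w i * w j * (B i ∩ B j).indicator (1 : Ω → ℝ) ω) μ := by
    intro i j
    split_ifs
    · exact integrable_zero _ _ _
    · exact (hint _ ((hB i).inter (hB j))).const_mul _
  have hi1 : ∀ i, Integrable (fun ω => w i * (B i).indicator (1 : Ω → ℝ) ω) μ :=
    fun i => (hint _ (hB i)).const_mul _
  have hmono := integral_mono ((integrable_finsetSum _ fun i _ => hi1 i).sub
    (integrable_finsetSum _ fun i _ => integrable_finsetSum _ fun j _ => hi2 i j))
    (hint _ (MeasurableSet.iUnion hB)) hpt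
  rw [integral_indicator_one (MeasurableSet.iUnion hB)] at hmono
  refine le_trans ?_ hmono
  simp only [Pi.sub_apply]
  rw [integral_sub (integrable_finsetSum _ fun i _ => hi1 i)
    (integrable_finsetSum _ fun i _ => integrable_finsetSum _ fun j _ => hi2 i j),
    integral_finsetSum _ fun i _ => hi1 i,
    integral_finsetSum _ fun i _ => integrable_finsetSum _ fun j _ => hi2 i j]
  refine sub_le_sub ?_ ?_
  · rw [← nsmul_eq_mul, ← Finset.card_univ, ← Finset.sum_const]
    refine Finset.sum_le_sum fun i _ => ?_
    rw [integral_const_mul, integral_indicator_one (hB i), hEU, mul_left_comm, hwU]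
    exact mul_le_mul_of_nonneg_right (hle i) hs.le
  · have : ((Fintype.card ι : ℝ) * s) ^ 2 = ∑ _i : ι, ∑ _j : ι, s ^ 2 := by
      simp; ring
    rw [this]
    refine Finset.sum_le_sum fun i _ => ?_
    rw [integral_finsetSum _ fun j _ => hi2 i j]
    refine Finset.sum_le_sum fun j _ => ?_
    by_cases hij : i = j
    · simp only [hij, if_true, integral_zero]; positivity
    · simp only [hij, if_false]
      rw [integral_const_mul, integral_indicator_one ((hB i).inter (hB j))]
      calc w i * w j * μ.real (B i ∩ B j) ≤ w i * w j * μ.real (U i ∩ U j) := by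
            have := hw0 i
            have := hw0 j
            gcongr
            · exact measure_ne_top _ _
            · exact Set.inter_subset_right
            · exact Set.inter_subset_right
        _ = (w i * μ.real (U i)) * (w j * μ.real (U j)) := by rw [hUU i j hij]; ring
        _ = s ^ 2 := by rw [hwU, hwU, sq]

/-! ### Which instructions each event depends on -/

section Measurability

variable {d : ℕ}

/-- The events which depend only on the instructions indexed by `S`. -/
abbrev instructionSigma (S : Set (TreeVertex d × ℕ)) : MeasurableSpace (FrogInstructions d) :=
  ⨆ a ∈ S, MeasurableSpace.comap (fun ω : FrogInstructions d => ω a) ⊤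

theorem instructionSigma_mono {S T : Set (TreeVertex d × ℕ)} (h : S ⊆ T) :
    instructionSigma S ≤ instructionSigma T :=
  biSup_mono h

theorem comap_eval_le (a : TreeVertex d × ℕ) :
    MeasurableSpace.comap (fun ω : FrogInstructions d => ω a) ⊤ ≤ MeasurableSpace.pi :=
  (measurable_pi_apply (X := fun _ : TreeVertex d × ℕ => FrogStep d) a).comap_le

theorem instructionSigma_le (S : Set (TreeVertex d × ℕ)) :
    instructionSigma S ≤ MeasurableSpace.pi :=
  iSup₂_le fun a _ => comap_eval_le a

theorem measurableSet_instruction_eq {S : Set (TreeVertex d × ℕ)} {a : TreeVertex d × ℕ}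
    (ha : a ∈ S) (t : FrogStep d) :
    MeasurableSet[instructionSigma S] {ω : FrogInstructions d | ω a = t} :=
  le_iSup₂ (f := fun a (_ : a ∈ S) =>
    MeasurableSpace.comap (fun ω : FrogInstructions d => ω a) ⊤) a ha _ ⟨{t}, trivial, rfl⟩

/-- The restriction to instructions from `k` on makes the future of the walk independent of its
current step. -/
theorem measurableSet_reaches (v w : TreeVertex d) (n k : ℕ) (x : TreeVertex d) :
    MeasurableSet[instructionSigma (d := d) {a | a.1 = v ∧ k ≤ a.2}]
      {ω | Reaches ω v w n k x} := by
  induction n generalizing k x with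
  | zero => exact MeasurableSet.const _
  | succ n ih =>
    have h : ∀ y, MeasurableSet[instructionSigma (d := d) {a | a.1 = v ∧ k ≤ a.2}]
        {ω | Reaches ω v w n (k + 1) y} := fun y =>
      instructionSigma_mono (S := {a | a.1 = v ∧ k + 1 ≤ a.2}) (T := {a | a.1 = v ∧ k ≤ a.2})
        (fun a ha => ⟨ha.1, (Nat.le_succ k).trans ha.2⟩) _ (ih (k + 1) y)
    have hk : ∀ t, MeasurableSet[instructionSigma (d := d) {a | a.1 = v ∧ k ≤ a.2}]
        {ω | ω (v, k) = t} := fun t =>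
      measurableSet_instruction_eq (S := {a | a.1 = v ∧ k ≤ a.2}) ⟨rfl, le_rfl⟩ t
    have : {ω : FrogInstructions d | Reaches ω v w (n + 1) k x} =
        {_ω | x = w} ∪ (({ω | ω (v, k) = FrogStep.toward} ∩
          {ω | Reaches ω v w n (k + 1) x.tail}) ∪
          ⋃ i, {ω | ω (v, k) = FrogStep.away i} ∩ {ω | Reaches ω v w n (k + 1) (i :: x)}) := by
      ext ω; simp [Reaches]
    rw [this]
    exact (MeasurableSet.const _).union (((hk _).inter (h _)).union
      (MeasurableSet.iUnion fun i => (hk _).inter (h _)))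

/-- The events which depend only on the instructions of the frogs in `V`. -/
abbrev frogSigma (V : Set (TreeVertex d)) : MeasurableSpace (FrogInstructions d) :=
  instructionSigma (Prod.fst ⁻¹' V)

theorem frogSigma_mono {V W : Set (TreeVertex d)} (h : V ⊆ W) : frogSigma V ≤ frogSigma W :=
  instructionSigma_mono (Set.preimage_mono h)

theorem measurableSet_hits {V : Set (TreeVertex d)} {v : TreeVertex d} (hv : v ∈ V)
    (w : TreeVertex d) : MeasurableSet[frogSigma V] {ω | Hits ω v w} := by
  have : {ω : FrogInstructions d | Hits ω v w} = ⋃ n, {ω | Reaches ω v w n 0 v} := by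
    ext ω; simp [Hits]
  rw [this]
  refine MeasurableSet.iUnion fun n => ?_
  refine instructionSigma_mono ?_ _ (measurableSet_reaches v w n 0 v)
  rintro ⟨u, k⟩ ⟨h, -⟩
  rw [Set.mem_preimage, show u = v from h]
  exact hv

theorem measurableSet_relay (x : TreeVertex d) (i j : Fin d) :
    MeasurableSet[frogSigma {x, i :: x}] {ω | Relay ω x i j} :=
  (measurableSet_hits (by simp) _).union
    ((measurableSet_hits (by simp) _).inter (measurableSet_hits (by simp) _))

theorem setOf_returns_succ (n : ℕ) (x : TreeVertex d) :
    {ω : FrogInstructions d | Returns ω (n + 1) x} = ⋃ ij : Fin d × Fin d,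
      {ω | Relay ω x ij.1 ij.2} ∩ {ω | Returns ω n (ij.2 :: ij.1 :: x)} := by
  ext ω; simp [Returns]

theorem measurableSet_returns (n : ℕ) (x : TreeVertex d) :
    MeasurableSet[frogSigma {v | x <:+ v}] {ω | Returns ω n x} := by
  induction n generalizing x with
  | zero => exact measurableSet_hits (List.suffix_refl x) _
  | succ n ih =>
    rw [setOf_returns_succ]
    refine MeasurableSet.iUnion fun ij => MeasurableSet.inter ?_ ?_
    · refine frogSigma_mono ?_ _ (measurableSet_relay x ij.1 ij.2)
      rintro v (rfl | rfl)
      · exact List.suffix_refl _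
      · exact List.suffix_cons _ _
    · refine frogSigma_mono ?_ _ (ih (ij.2 :: ij.1 :: x))
      exact fun v hv => ((List.suffix_cons _ _).trans (List.suffix_cons _ _)).trans hv

end Measurability

/-! ### Independence of events with disjoint instruction sets -/

section Independence

variable {d : ℕ} {q p : ℝ} [IsProbabilityMeasure (frogStepLaw d q p)]

instance : IsProbabilityMeasure (frogMeasure d q p) := by
  unfold frogMeasure; infer_instance

open ProbabilityTheory in
theorem measureReal_inter_of_disjoint {S T : Set (TreeVertex d × ℕ)} (hST : Disjoint S T)
    {A B : Set (FrogInstructions d)} (hA : MeasurableSet[instructionSigma S] A)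
    (hB : MeasurableSet[instructionSigma T] B) :
    (frogMeasure d q p).real (A ∩ B) = (frogMeasure d q p).real A * (frogMeasure d q p).real B := by
  have hind : iIndep (fun a : TreeVertex d × ℕ =>
      MeasurableSpace.comap (fun ω : FrogInstructions d => ω a) ⊤) (frogMeasure d q p) :=
    iIndepFun_infinitePi (P := fun _ : TreeVertex d × ℕ => frogStepLaw d q p)
      (X := fun _ t => t) fun _ => measurable_id
  have := (Indep_iff _ _ _).1 (indep_iSup_of_disjoint comap_eval_le hind hST) A B hA hB
  simp only [Measure.real, this, ENNReal.toReal_mul]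

theorem measureReal_inter_of_disjoint_frogs {V W : Set (TreeVertex d)} (hVW : Disjoint V W)
    {A B : Set (FrogInstructions d)} (hA : MeasurableSet[frogSigma V] A)
    (hB : MeasurableSet[frogSigma W] B) :
    (frogMeasure d q p).real (A ∩ B) = (frogMeasure d q p).real A * (frogMeasure d q p).real B :=
  measureReal_inter_of_disjoint (hVW.preimage _) hA hB

theorem measureReal_instruction_eq (a : TreeVertex d × ℕ) (t : FrogStep d) :
    (frogMeasure d q p).real {ω | ω a = t} = (frogStepLaw d q p).real {t} := by
  have := (measurePreserving_eval_infinitePi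
    (fun _ : TreeVertex d × ℕ => frogStepLaw d q p) a).measure_preimage
      (s := {t}) (MeasurableSet.nullMeasurableSet trivial)
  simp only [Measure.real]
  rw [← this]
  rfl

end Independence

theorem frogStepLaw_real_toward {d : ℕ} {q p : ℝ} (h : 0 ≤ q * p) :
    (frogStepLaw d q p).real {FrogStep.toward} = q * p := by
  have hm : ∀ s : Set (FrogStep d), MeasurableSet s := fun _ => trivial
  simp [frogStepLaw, Measure.real, Measure.dirac_apply' _ (hm _), Set.indicator, h]

theorem frogStepLaw_real_away {d : ℕ} {q p : ℝ} (h : 0 ≤ q * ((1 - p) / d)) (i : Fin d) :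
    (frogStepLaw d q p).real {FrogStep.away i} = q * ((1 - p) / d) := by
  have hm : ∀ s : Set (FrogStep d), MeasurableSet s := fun _ => trivial
  simp [frogStepLaw, Measure.real, Measure.dirac_apply' _ (hm _), Set.indicator, h]

/-! ### From subharmonic functions to hitting probabilities -/

section HittingProbability

variable {d : ℕ} {q p : ℝ} [IsProbabilityMeasure (frogStepLaw d q p)]

theorem le_measureReal_reaches_succ (hq : 0 ≤ q) (hp0 : 0 ≤ p) (hp1 : p ≤ 1)
    (v w : TreeVertex d) (n k : ℕ) (x : TreeVertex d) :
    q * (p * (frogMeasure d q p).real {ω | Reaches ω v w n (k + 1) x.tail} +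
      ∑ i : Fin d, (1 - p) / d *
        (frogMeasure d q p).real {ω | Reaches ω v w n (k + 1) (i :: x)}) ≤
      (frogMeasure d q p).real {ω | Reaches ω v w (n + 1) k x} := by
  set A : FrogStep d → Set (FrogInstructions d) := fun t => {ω | ω (v, k) = t}
  set R : TreeVertex d → Set (FrogInstructions d) := fun y => {ω | Reaches ω v w n (k + 1) y}
  have hA : ∀ t, MeasurableSet (A t) := fun t =>
    instructionSigma_le {(v, k)} _ (measurableSet_instruction_eq (Set.mem_singleton _) t)
  have hR : ∀ y, MeasurableSet (R y) := fun y =>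
    instructionSigma_le _ _ (measurableSet_reaches v w n (k + 1) y)
  have hAR : ∀ t y, (frogMeasure d q p).real (A t ∩ R y) =
      (frogStepLaw d q p).real {t} * (frogMeasure d q p).real (R y) := by
    intro t y
    rw [measureReal_inter_of_disjoint (S := {(v, k)}) ?_
      (measurableSet_instruction_eq (Set.mem_singleton _) t) (measurableSet_reaches v w n (k + 1) y), measureReal_instruction_eq]
    rw [Set.disjoint_singleton_left]
    rintro ⟨-, h⟩
    exact absurd h (Nat.not_succ_le_self k)
  have hdisj : ∀ {s t : FrogStep d} {y z : TreeVertex d}, s ≠ t →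
      Disjoint (A s ∩ R y) (A t ∩ R z) := by
    intro s t y z hst
    refine Set.disjoint_left.2 fun ω h h' => hst ?_
    exact h.1.symm.trans h'.1
  have hsub : (A FrogStep.toward ∩ R x.tail) ∪ ⋃ i, A (FrogStep.away i) ∩ R (i :: x) ⊆
      {ω | Reaches ω v w (n + 1) k x} := by
    intro ω hω
    simp only [Set.mem_union, Set.mem_iUnion] at hω
    exact Or.inr hω
  refine le_trans (le_of_eq ?_) (measureReal_mono hsub)
  rw [measureReal_union, measureReal_iUnion_fintype, hAR, frogStepLaw_real_toward (by positivity),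
    mul_add, Finset.mul_sum]
  · congr 1
    · ring
    · refine Finset.sum_congr rfl fun i _ => ?_
      rw [hAR, frogStepLaw_real_away]
      · ring
      · have := sub_nonneg.2 hp1
        positivity
  · intro i j hij
    exact hdisj (by simpa using hij)
  · exact fun i => (hA _).inter (hR _)
  · simp only [Set.disjoint_iUnion_right]
    exact fun i => hdisj (by simp)
  · exact MeasurableSet.iUnion fun i => (hA _).inter (hR _)

/-- A bounded function which is subharmonic off `w` for a walk killed at a positive rate is a lower
bound for the probability of visiting `w`. -/
theorem le_measureReal_reaches {q₀ : ℝ} (hq0 : 0 ≤ q₀) (hq : q₀ ≤ q) (hp0 : 0 ≤ p) (hp1 : p ≤ 1)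
    {w : TreeVertex d} {φ : TreeVertex d → ℝ} (hφ1 : ∀ x, φ x ≤ 1)
    (hφ : ∀ x ≠ w, φ x ≤ q₀ * (p * φ x.tail + ∑ i : Fin d, (1 - p) / d * φ (i :: x)))
    (v : TreeVertex d) (n k : ℕ) (x : TreeVertex d) (hd : d ≠ 0) :
    φ x - q₀ ^ n ≤ (frogMeasure d q p).real {ω | Reaches ω v w n k x} := by
  induction n generalizing k x with
  | zero =>
    rw [pow_zero]
    exact (sub_nonpos.2 (hφ1 x)).trans measureReal_nonneg
  | succ n ih =>
    by_cases hx : x = w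
    · have : {ω : FrogInstructions d | Reaches ω v w (n + 1) k x} = Set.univ := by
        ext ω; simp [Reaches, hx]
      rw [this, probReal_univ]
      linarith [hφ1 x, pow_nonneg hq0 (n + 1)]
    · have hp1' := sub_nonneg.2 hp1
      have hd' : (d : ℝ) ≠ 0 := Nat.cast_ne_zero.2 hd
      calc φ x - q₀ ^ (n + 1)
          ≤ q₀ * (p * φ x.tail + ∑ i : Fin d, (1 - p) / d * φ (i :: x)) - q₀ ^ (n + 1) :=
            sub_le_sub_right (hφ x hx) _
        -- The step probabilities of a surviving frog sum to one, so the constant `q₀ ^ n` passes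
        -- through the average.
        _ = q₀ * (p * (φ x.tail - q₀ ^ n) +
              ∑ i : Fin d, (1 - p) / d * (φ (i :: x) - q₀ ^ n)) := by
            simp only [mul_sub, Finset.sum_sub_distrib, Finset.sum_const, Finset.card_univ,
              Fintype.card_fin, nsmul_eq_mul]
            field_simp
            ring
        _ ≤ q₀ * (p * (frogMeasure d q p).real {ω | Reaches ω v w n (k + 1) x.tail} +
              ∑ i : Fin d, (1 - p) / d *
                (frogMeasure d q p).real {ω | Reaches ω v w n (k + 1) (i :: x)}) := by
            gcongr <;> exact ih _ _
        _ ≤ q * (p * (frogMeasure d q p).real {ω | Reaches ω v w n (k + 1) x.tail} +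
              ∑ i : Fin d, (1 - p) / d *
                (frogMeasure d q p).real {ω | Reaches ω v w n (k + 1) (i :: x)}) := by
            gcongr
        _ ≤ _ := le_measureReal_reaches_succ (hq0.trans hq) hp0 hp1 v w n k x

/-- The error `q₀ ^ n` vanishes in the limit. Using `q₀ < 1` in place of `q` covers `q = 1` without
any transience argument. -/
theorem le_measureReal_hits {q₀ : ℝ} (hq0 : 0 ≤ q₀) (hq1 : q₀ < 1) (hq : q₀ ≤ q) (hp0 : 0 ≤ p)
    (hp1 : p ≤ 1) {w : TreeVertex d} {φ : TreeVertex d → ℝ} (hφ1 : ∀ x, φ x ≤ 1)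
    (hφ : ∀ x ≠ w, φ x ≤ q₀ * (p * φ x.tail + ∑ i : Fin d, (1 - p) / d * φ (i :: x)))
    (v : TreeVertex d) (hd : d ≠ 0) :
    φ v ≤ (frogMeasure d q p).real {ω | Hits ω v w} := by
  have hlim : Filter.Tendsto (fun n : ℕ => φ v - q₀ ^ n) Filter.atTop (nhds (φ v)) := by
    simpa using (tendsto_pow_atTop_nhds_zero_of_lt_one hq0 hq1).const_sub (φ v)
  refine le_of_tendsto' hlim fun n => ?_
  exact (le_measureReal_reaches hq0 hq hp0 hp1 hφ1 hφ v n 0 v hd).trans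
    (measureReal_mono fun ω h => ⟨n, h⟩)

end HittingProbability

/-! ### Supercritical relays and recurrence -/

section Relay

variable {d : ℕ} {q p : ℝ} [IsProbabilityMeasure (frogStepLaw d q p)]

/-- If the first frog misses the grandchild but wakes the child, the child's independent frog gets a
second chance: `r ^ 2 + (r - r ^ 2) * r`. -/
theorem le_measureReal_relay {r : ℝ} (hr0 : 0 ≤ r) (hr1 : r ≤ 1)
    (h1 : ∀ (x : TreeVertex d) i, r ≤ (frogMeasure d q p).real {ω | Hits ω x (i :: x)})
    (h2 : ∀ (x : TreeVertex d) i j,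
      r ^ 2 ≤ (frogMeasure d q p).real {ω | Hits ω x (j :: i :: x)})
    (x : TreeVertex d) (i j : Fin d) :
    2 * r ^ 2 - r ^ 3 ≤ (frogMeasure d q p).real {ω | Relay ω x i j} := by
  set μ := frogMeasure d q p
  set Y : Set (FrogInstructions d) := {ω | Hits ω x (i :: x)} with hYdef
  set Z : Set (FrogInstructions d) := {ω | Hits ω x (j :: i :: x)} with hZdef
  set W : Set (FrogInstructions d) := {ω | Hits ω (i :: x) (j :: i :: x)} with hWdef
  have hY : MeasurableSet[frogSigma {x}] Y := measurableSet_hits (Set.mem_singleton _) _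
  have hZ : MeasurableSet[frogSigma {x}] Z := measurableSet_hits (Set.mem_singleton _) _
  have hW : MeasurableSet[frogSigma {i :: x}] W := measurableSet_hits (Set.mem_singleton _) _
  have hdisj : Disjoint ({x} : Set (TreeVertex d)) {i :: x} := by simp
  have hrelay : {ω | Relay ω x i j} = Z ∪ (Y \ Z) ∩ W := by
    ext ω
    simp only [hYdef, hZdef, hWdef, Relay, Set.mem_ofPred_eq, Set.mem_union, Set.mem_inter_iff,
      Set.mem_sdiff]
    tauto
  have hYW := (instructionSigma_le _ _ (hY.diff hZ)).inter (instructionSigma_le _ _ hW)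
  rw [hrelay, measureReal_union (Set.disjoint_sdiff_right.mono_right Set.inter_subset_left) hYW,
    measureReal_inter_of_disjoint_frogs hdisj (hY.diff hZ) hW]
  have hy : r ≤ μ.real Y := h1 x i
  have hz : r ^ 2 ≤ μ.real Z := h2 x i j
  have hw : r ≤ μ.real W := h1 (i :: x) j
  have hw1 : μ.real W ≤ 1 := measureReal_le_one
  have hyz : μ.real Y - μ.real Z ≤ μ.real (Y \ Z) := le_measureReal_sdiff
  nlinarith [mul_nonneg (sub_nonneg.2 hz) (sub_nonneg.2 hw1),
    mul_nonneg (sub_nonneg.2 hyz) (hr0.trans hw),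
    mul_nonneg (sub_nonneg.2 hy) (hr0.trans hw),
    mul_nonneg (sub_nonneg.2 hw) (mul_nonneg hr0 (sub_nonneg.2 hr1))]

theorem disjoint_subtrees {x y : TreeVertex d} (hlen : x.length = y.length) (hxy : x ≠ y) :
    Disjoint {v : TreeVertex d | x <:+ v} {v | y <:+ v} := by
  refine Set.disjoint_left.2 fun v hx hy => hxy ?_
  exact (List.suffix_of_suffix_length_le hx hy hlen.le).eq_of_length hlen

/-- Induction over relays. Those from `x` to different grandchildren may be dependent, but the
continuations live in disjoint subtrees, and only their pairwise independence enters the quadratic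
loss. The small factor `s` keeps that loss below the linear gain. -/
theorem le_measureReal_returns {r h s : ℝ} (hr0 : 0 ≤ r) (hr1 : r ≤ 1) (hh0 : 0 < h)
    (hh1 : h ≤ 1) (hs0 : 0 < s) (hs1 : s ≤ 1)
    (h0 : ∀ x : TreeVertex d, h ^ x.length ≤ (frogMeasure d q p).real {ω | Hits ω x []})
    (h1 : ∀ (x : TreeVertex d) i, r ≤ (frogMeasure d q p).real {ω | Hits ω x (i :: x)})
    (h2 : ∀ (x : TreeVertex d) i j,
      r ^ 2 ≤ (frogMeasure d q p).real {ω | Hits ω x (j :: i :: x)})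
    (hgrow : 1 ≤ h ^ 2 * ((d : ℝ) ^ 2 * (2 * r ^ 2 - r ^ 3) - (d : ℝ) ^ 4 * s))
    (n : ℕ) (x : TreeVertex d) :
    s * h ^ x.length ≤ (frogMeasure d q p).real {ω | Returns ω n x} := by
  induction n generalizing x with
  | zero =>
    exact (mul_le_of_le_one_left (pow_nonneg hh0.le _) hs1).trans (h0 x)
  | succ n ih =>
    rw [setOf_returns_succ]
    have key := measureReal_iUnion_inter_ge (μ := frogMeasure d q p)
      (E := fun ij : Fin d × Fin d => {ω | Relay ω x ij.1 ij.2})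
      (U := fun ij => {ω | Returns ω n (ij.2 :: ij.1 :: x)})
      (e := 2 * r ^ 2 - r ^ 3) (s := s * h ^ (x.length + 2))
      (fun ij => instructionSigma_le _ _ (measurableSet_relay x ij.1 ij.2))
      (fun ij => instructionSigma_le _ _ (measurableSet_returns n _))
      (fun ij => measureReal_inter_of_disjoint_frogs ?_ (measurableSet_relay x ij.1 ij.2)
        (measurableSet_returns n _))
      (fun ij ij' hne => measureReal_inter_of_disjoint_frogs
        (disjoint_subtrees (by simp) ?_) (measurableSet_returns n _) (measurableSet_returns n _))
      (by positivity)
      (fun ij => le_measureReal_relay hr0 hr1 h1 h2 x ij.1 ij.2)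
      (fun ij => ih (ij.2 :: ij.1 :: x))
    · refine le_trans ?_ key
      simp only [Fintype.card_prod, Fintype.card_fin, Nat.cast_mul]
      have hle : h ^ (x.length + 2) ≤ 1 := pow_le_one₀ hh0.le hh1
      set t := s * h ^ x.length with ht
      have ht0 : 0 ≤ t := by positivity
      have e1 : s * h ^ (x.length + 2) = t * h ^ 2 := by rw [ht]; ring
      have e2 : t * h ^ 2 ≤ s := by
        rw [← e1]; exact mul_le_of_le_one_right hs0.le hle
      rw [e1]
      calc t ≤ t * (h ^ 2 * ((d : ℝ) ^ 2 * (2 * r ^ 2 - r ^ 3) - (d : ℝ) ^ 4 * s)) :=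
            le_mul_of_one_le_right ht0 hgrow
        _ ≤ t * (h ^ 2 * ((d : ℝ) ^ 2 * (2 * r ^ 2 - r ^ 3) - (d : ℝ) ^ 4 * (t * h ^ 2))) := by
            gcongr
        _ = _ := by ring
    · refine Set.disjoint_left.2 fun v hv hv' => ?_
      have := List.IsSuffix.length_le hv'
      rcases hv with rfl | rfl <;> simp at this
    · intro H
      simp only [List.cons.injEq, and_true] at H
      exact hne (Prod.ext H.2 H.1)

/-- The limsup of events of probability at least `c` again has probability at least `c`, by
continuity from above. -/
theorem frogRecurrent_pos {c : ℝ} (hc : 0 < c)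
    (hret : ∀ n, c ≤ (frogMeasure d q p).real {ω | Returns ω n []}) :
    0 < frogMeasure d q p {ω : FrogInstructions d | FrogRecurrent ω} := by
  set A : ℕ → Set (FrogInstructions d) := fun N => ⋃ n ≥ N, {ω | Returns ω n []} with hAdef
  have hm : ∀ n, MeasurableSet {ω : FrogInstructions d | Returns ω n []} := fun n =>
    instructionSigma_le _ _ (measurableSet_returns n _)
  have hA : ∀ N, MeasurableSet (A N) := fun N =>
    MeasurableSet.iUnion fun n => MeasurableSet.iUnion fun _ => hm n
  have hanti : Antitone A := fun M N hMN =>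
    Set.biUnion_subset_biUnion_left fun n hn => le_trans hMN hn
  have hsub : ⋂ N, A N ⊆ {ω | FrogRecurrent ω} := by
    intro ω hω
    refine frogRecurrent_of_frequently_returns fun N => ?_
    simpa [hAdef] using Set.mem_iInter.1 hω N
  have hlim := tendsto_measure_iInter_atTop (μ := frogMeasure d q p)
    (fun N => (hA N).nullMeasurableSet) hanti ⟨0, measure_ne_top _ _⟩
  have hle : ENNReal.ofReal c ≤ frogMeasure d q p (⋂ N, A N) := by
    refine ge_of_tendsto' hlim fun N => ?_
    refine (ENNReal.ofReal_le_of_le_toReal (hret N)).trans (measure_mono ?_)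
    exact Set.subset_biUnion_of_mem (u := fun n => {ω | Returns ω n []}) (le_refl N)
  exact (ENNReal.ofReal_pos.2 hc).trans_le (hle.trans (measure_mono hsub))

end Relay

/-! ### Numerical constants and conclusion -/

theorem hits_step_bound {d p : ℝ} (hd : 2 ≤ d) (hp : p ∈ Set.Icc (0.4950 : ℝ) 0.4975) :
    0.9 / d ≤ 0.9999998 * (p * (0.9 / d) ^ 2 +
      (1 - p) / d * (1 + (d - 1) * (0.98 * (0.9 / d)))) := by
  obtain ⟨hp1, hp2⟩ := hp
  have hd0 : 0 < d := by linarith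
  have : 0.9999998 * (p * (0.9 / d) ^ 2 +
      (1 - p) / d * (1 + (d - 1) * (0.98 * (0.9 / d)))) - 0.9 / d =
      (0.9999998 * (p * 0.81 + (1 - p) * (d + (d - 1) * 0.882)) - 0.9 * d) / d ^ 2 := by
    field_simp
    ring
  rw [← sub_nonneg, this]
  apply div_nonneg _ (by positivity)
  -- The numerator is bilinear in `p` and `d`; its worst case is the corner `p = 0.4975`, `d = 2`.
  nlinarith [mul_nonneg (sub_nonneg.2 hp2) (sub_nonneg.2 hd)]

theorem theorem1p1 (d : ℕ) (hd : 2 ≤ d) (p q : ℝ)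
    (hp : p ∈ Set.Icc (0.4950 : ℝ) 0.4975) (hq : q ∈ Set.Icc (0.9999998 : ℝ) 1) :
    0 < frogMeasure d q p {ω : FrogInstructions d | FrogRecurrent ω} := by
  have hd0 : d ≠ 0 := by omega
  have hdR : (2 : ℝ) ≤ d := by exact_mod_cast hd
  have hdpos : (0 : ℝ) < d := by linarith
  have hp0 : 0 ≤ p := by linarith [hp.1]
  have hp1 : p ≤ 1 := by linarith [hp.2]
  have := isProbabilityMeasure_frogStepLaw (d := d) (q := q) (p := p) hd0
    ⟨by linarith [hq.1], hq.2⟩ ⟨hp0, hp1⟩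
  set r : ℝ := 0.9 / d with hr
  have hr0 : 0 ≤ r := by positivity
  have hrd : r * d = 0.9 := div_mul_cancel₀ _ hdpos.ne'
  have hr1 : r ≤ 0.45 := by
    rw [hr, div_le_iff₀ hdpos]; linarith
  have hits : ∀ v w : TreeVertex d,
      potential r 0.98 w v ≤ (frogMeasure d q p).real {ω | Hits ω v w} := fun v w =>
    le_measureReal_hits (q₀ := 0.9999998) (by norm_num) (by norm_num) hq.1 hp0 hp1
      (potential_le_one hr0 (by linarith) (by norm_num) (by norm_num))
      (fun x hx => potential_le_step hr0 (by linarith) (by norm_num) hp0 (by norm_num)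
        -- The constant 0.98 lies just below `0.495 / 0.505`: at `p = 0.495` one has `p + (1 - p) *
        -- 0.98 ^ 2 = 0.980002`, leaving room for the killing.
        (by nlinarith [hp.1]) (hits_step_bound hdR hp) hx) v hd0
  have hd4 : (d : ℝ) ^ 4 * (0.2 / (d : ℝ) ^ 4) = 0.2 := by field_simp
  have hs1 : 0.2 / (d : ℝ) ^ 4 ≤ 1 := by
    rw [div_le_one (by positivity)]
    have : (1 : ℝ) ≤ (d : ℝ) ^ 4 := one_le_pow₀ (by linarith)
    linarith
  refine frogRecurrent_pos (c := 0.2 / (d : ℝ) ^ 4) (by positivity) fun n => ?_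
  have key := le_measureReal_returns (d := d) (r := r) (h := 0.98) (q := q) (p := p) hr0 (by linarith)
    (by norm_num) (by norm_num) (by positivity) hs1 (fun x => ?_) (fun x i => ?_)
    (fun x i j => ?_) ?_ n []
  · simpa using key
  · simpa [potential_nil_eq] using hits x []
  · simpa [potential_of_suffix (List.suffix_cons i x)] using hits x (i :: x)
  · simpa [potential_of_suffix ((List.suffix_cons i x).trans (List.suffix_cons j _)), add_assoc]
      using hits x (j :: i :: x)
  -- As `r ≤ 0.45`, the growth factor is at least `0.98 ^ 2 * (0.81 * 1.55 - 0.2) > 1.01`.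
  · rw [hd4, show (d : ℝ) ^ 2 * (2 * r ^ 2 - r ^ 3) = (r * d) ^ 2 * (2 - r) by ring, hrd]
    linarith
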